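/- Let $\kappa<\lambda$ be cardinals with $\kappa$ infinite and regular, let $\tau$ be a vocabulary, let $K_\lambda$ be a family of $\tau$-models each of cardinality $\lambda$, and let $\varphi(\bar x,\bar y)$ be a formula (of any logic; all that matters is that its satisfaction is preserved by isomorphisms) in the vocabulary $\tau$ with $\mathrm{lg}(\bar x)=\mathrm{lg}(\bar y)=n<\aleph_0$ that is asymmetric, i.e. $M\models\varphi[\bar a,\bar b]$ implies $M\models\neg\varphi[\bar b,\bar a]$ for all $M\in K_\lambda$ and $\bar a,\bar b\in{}^nM$. For a linear order $J$ and a model $M$, a sequence $\langle \bar a_s:s\in J\rangle$ of $n$-tuples from $M$ is called weakly $(\kappa,\varphi(\bar x,\bar y))$-skeleton like inside $M$ if $\varphi$ is asymmetric in $M$ and the following hold: (i) for all $s,t\in J$, $M\models\varphi[\bar a_s,\bar a_t]$ if and only if $s<t$; (ii) for every $\bar b\in{}^nM$ and each of the two formulas $\theta(\bar x)\in\{\varphi(\bar x,\bar b),\varphi(\bar b,\bar x)\}$ there is a set $J'\subseteq J$ with $|J'|<\kappa$ such that whenever $s,t\in J$ realize the same quantifier-free type over $J'$ in the linear order $J$,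 then $M\models\theta[\bar a_s]$ if and only if $M\models\theta[\bar a_t]$. Suppose that for every linear order $J$ of cardinality $\lambda$ there are $M\in K_\lambda$ and $n$-tuples $\bar a_s$ from $M$ for $s\in J$ such that $\langle\bar a_s:s\in J\rangle$ is weakly $(\kappa,\varphi(\bar x,\bar y))$-skeleton like inside $M$. Then there are $2^\lambda$ pairwise non-isomorphic models in $K_\lambda$. -/

import Mathlib

open Cardinal

universe u v w

/-- A vocabulary: function symbols and relation symbols, each with a type indexing its argument
places. Places may be infinite in number (`FirstOrder.Language` allows finite arities only). -/
structure Vocabulary where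
  Func : Type v
  funcPlaces : Func → Type w
  Rel : Type v
  relPlaces : Rel → Type w

namespace Vocabulary

/-- A `τ`-model. -/
structure Model (τ : Vocabulary.{v, w}) where
  Carrier : Type u
  funcMap : ∀ F : τ.Func, (τ.funcPlaces F → Carrier) → Carrier
  relMap : ∀ R : τ.Rel, (τ.relPlaces R → Carrier) → Prop

variable {τ : Vocabulary.{v, w}}

/-- An isomorphism from the `τ`-model `M` onto the `τ`-model `N`. -/
structure Iso (M N : Model.{u} τ) where
  toEquiv : M.Carrier ≃ N.Carrier
  map_func : ∀ (F : τ.Func) (x : τ.funcPlaces F → M.Carrier),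
    toEquiv (M.funcMap F x) = N.funcMap F (fun i => toEquiv (x i))
  map_rel : ∀ (R : τ.Rel) (x : τ.relPlaces R → M.Carrier),
    M.relMap R x ↔ N.relMap R (fun i => toEquiv (x i))

/-- A formula `φ(x̄, ȳ)` in the vocabulary `τ` with `ℓg(x̄) = ℓg(ȳ) = n`, of an arbitrary logic
(first-order, infinitary, second-order, ...), given by its satisfaction relation: `φ.Holds M a b`
is `M ⊨ φ[a, b]`. Satisfaction of formulas is preserved by isomorphisms, in every logic. -/
structure BinFormula (τ : Vocabulary.{v, w}) (n : ℕ) where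
  Holds : ∀ M : Model.{u} τ, (Fin n → M.Carrier) → (Fin n → M.Carrier) → Prop
  holds_iso : ∀ (M N : Model.{u} τ) (f : Iso M N) (a b : Fin n → M.Carrier),
    Holds M a b ↔ Holds N (fun i => f.toEquiv (a i)) (fun i => f.toEquiv (b i))

/-- `φ(x̄, ȳ)` is asymmetric in `M`: `M ⊨ φ(x̄, ȳ) → ¬ φ(ȳ, x̄)`. -/
def BinFormula.AsymmetricIn {n : ℕ} (φ : BinFormula.{u} τ n) (M : Model.{u} τ) : Prop :=
  ∀ a b : Fin n → M.Carrier, φ.Holds M a b → ¬ φ.Holds M b a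

/-- `s` and `t` have the same quantifier-free type over `J` in the linear order `I`. -/
def SameQFType {I : Type u} [LinearOrder I] (J : Set I) (s t : I) : Prop :=
  ∀ j ∈ J, (s < j ↔ t < j) ∧ (s = j ↔ t = j) ∧ (j < s ↔ j < t)

/-- `⟨a s : s ∈ I⟩` is weakly `κ`-skeleton like for `Λ`, a set of conditions on `n`-tuples of the
model (those given by formulas with parameters). -/
def IsWeaklySkeletonLikeFor {I : Type u} [LinearOrder I] {A : Type u} {n : ℕ}
    (κ : Cardinal.{u}) (Λ : Set ((Fin n → A) → Prop)) (a : I → Fin n → A) : Prop :=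
  ∀ p ∈ Λ, ∃ J : Set I, #J < κ ∧ ∀ s t : I, SameQFType J s t → (p (a s) ↔ p (a t))

/-- `⟨a s : s ∈ I⟩` is weakly `(κ, φ(x̄, ȳ))`-skeleton like inside `M`. The set of conditions
consists of all `φ(x̄, b)` and all `ψ(x̄, b)`, where `b` ranges over all `n`-tuples of `M` and
`ψ(x̄, ȳ)` is `φ(ȳ, x̄)`. -/
structure IsWeaklySkeletonLike {I : Type u} [LinearOrder I] {n : ℕ} (κ : Cardinal.{u})
    (φ : BinFormula.{u} τ n) (M : Model.{u} τ) (a : I → Fin n → M.Carrier) : Prop where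
  asymm : φ.AsymmetricIn M
  skeleton : IsWeaklySkeletonLikeFor κ
    {p | ∃ b : Fin n → M.Carrier, p = (fun x => φ.Holds M x b) ∨ p = (fun x => φ.Holds M b x)} a
  holds_iff : ∀ s t : I, φ.Holds M (a s) (a t) ↔ s < t

end Vocabulary

/-!
The condition on a weakly skeleton-like sequence concerns a cut of the index order as follows: if
both sides of the cut have cofinality at least `κ`, then every `φ(x̄, b)` and `φ(b, x̄)` has one and
the same truth value at all `a s` with `s` near the cut, on either side. Thus if two such sequences
in one model are interleaved up to a pair of cuts, they are interleaved on the far sides of these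
cuts as well (`IsSkeleton.eventually_rel_of_frequently`). For two interleaved sequences that are
indexed by sums of reversed orders `X δ` and `X' δ` along a regular cardinal `τ`, this applies at
all `δ` of cofinality at least `κ` in a club, and shows that `X δ` and `X' δ` are interleaved there
(`Interleaved.exists_closedUnder`). In particular `X δ` and `X' δ` cannot be `κ` and `κ⁺`, and since
the points of cofinality `κ` split into `τ` stationary sets (`exists_stationary_coloring`), orders
of cofinality `τ` can code all functions `τ → Bool` in such a way that interleaved sequences have
the same code (`eq_of_interleaved_codeOrder`). A second sum of this kind packs functions on several
regular cardinals into one order (`eq_of_interleaved_sumCodeOrder`).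

It remains to arrange that a model `M` of cardinality `lam` contains at most `lam` coding sequences
up to interleaving. A cut for which cofinally many elements of the left side lie in a set `B`, and
whose right side has cofinality at least `κ` and greater than the cardinality of `B`, is determined
by `B` and one further point `c`, an element on the right side that realizes the limit type over `B`
(`IsSkeleton.exists_locatesOver`, `LocatesOver.interleaved`). So the coding orders are put, reversed,
to the right of cuts of small cofinality, and `B` is an initial segment of an enumeration of `M` of
type `lam`. If `lam` is regular, then a short left side is contained in such a `B`. If `lam` is the
supremum of `cof lam` many regular cardinals `τ j`, then a sequence of a regular length between
`cof lam` and `lam` has cofinally many members in one `B`; coding orders of each cofinality `τ j`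
occur to the right of stationarily many of its initial segments, in particular some with `τ j`
larger than `B`. No cardinal arithmetic is needed. Hence each isomorphism class of models accounts
for at most `lam` of the `2 ^ lam` codes.
-/

namespace OrderCoding
open Filter Vocabulary

/-! ### Stationary sets of points of given cofinality -/

/-- Every subset of `X` of cardinality less than `c` has a strict upper bound; for a linear order
without greatest element this says that the cofinality is at least `c`. -/
def StrictlyDirected (c : Cardinal.{u}) (X : Type u) [LT X] : Prop :=
  ∀ s : Set X, #s < c → ∃ v, ∀ x ∈ s, x < v

/-- The initial segment below `δ` is `StrictlyDirected c`: the point `δ` has cofinality at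
least `c`. -/
def DirectedBelow {T : Type u} [LT T] (c : Cardinal.{u}) (δ : T) : Prop :=
  ∀ s : Set T, #s < c → (∀ x ∈ s, x < δ) → ∃ i < δ, ∀ x ∈ s, x < i

/-- `δ` is closed under `f`, that is, `f` maps the points below `δ` to points below `δ`. -/
def ClosedUnder {T : Type u} [LT T] (f : T → T) (δ : T) : Prop :=
  ∀ i < δ, f i < δ

lemma StrictlyDirected.mono {c d : Cardinal.{u}} {X : Type u} [LT X] (h : StrictlyDirected d X)
    (hcd : c ≤ d) : StrictlyDirected c X :=
  fun s hs => h s (hs.trans_le hcd)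

lemma strictlyDirected_toType {c : Cardinal.{u}} (hc : c.IsRegular) :
    StrictlyDirected c c.ord.ToType := by
  intro s hs
  by_contra! h
  have : IsCofinal s := fun v => h v
  have h1 := Order.cof_le this
  rw [Ordinal.cof_toType, hc.cof_ord] at h1
  exact absurd hs h1.not_gt

lemma mk_Iio_toType_lt {c : Cardinal.{u}} (i : c.ord.ToType) : #(Set.Iio i) < c := by
  simpa using mk_Iio_lt i (by simp)

lemma mk_Iic_toType_lt {c : Cardinal.{u}} (hc : ℵ₀ ≤ c) (i : c.ord.ToType) :
    #(Set.Iic i) < c := by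
  have := noMaxOrder hc
  obtain ⟨j, hj⟩ := exists_gt i
  exact (mk_le_mk_of_subset fun x (hx : x ≤ i) => hx.trans_lt hj).trans_lt (mk_Iio_toType_lt j)

lemma nonempty_toType {c : Cardinal.{u}} (hc : c.IsRegular) : Nonempty c.ord.ToType := by
  rw [← mk_ne_zero_iff, mk_ord_toType]
  exact hc.pos.ne'

/-- `η` is a strictly increasing sequence of length `κ` with supremum `δ`. -/
structure IsLadder {T : Type u} [LinearOrder T] (κ : Cardinal.{u}) (η : κ.ord.ToType → T)
    (δ : T) : Prop where
  strictMono : StrictMono η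
  lt : ∀ k, η k < δ
  cofinal : ∀ i < δ, ∃ k, i < η k

lemma IsLadder.directedBelow {T : Type u} [LinearOrder T] {κ : Cardinal.{u}} (hκ : κ.IsRegular)
    {η : κ.ord.ToType → T} {δ : T} (h : IsLadder κ η δ) : DirectedBelow κ δ := by
  intro s hs hsδ
  choose k hk using fun x : s => h.cofinal x (hsδ x x.2)
  obtain ⟨v, hv⟩ := strictlyDirected_toType hκ (Set.range k) (mk_range_le.trans_lt hs)
  exact ⟨η v, h.lt v, fun x hx =>
    (hk ⟨x, hx⟩).trans (h.strictMono (hv _ ⟨⟨x, hx⟩, rfl⟩))⟩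

variable {κ τ : Cardinal.{u}}

/-- The points of cofinality `κ` are stationary in `τ`. -/
lemma exists_ladder_closedUnder (hκ : κ.IsRegular) (hτ : τ.IsRegular) (hκτ : κ < τ)
    (f : τ.ord.ToType → τ.ord.ToType) :
    ∃ δ, (∃ η, IsLadder κ η δ) ∧ ClosedUnder f δ := by
  have hdir := strictlyDirected_toType hτ
  have hκmax := noMaxOrder hκ.aleph0_le
  choose g hg using fun i : τ.ord.ToType => hdir (f '' Set.Iic i ∪ {i}) (by
    refine (mk_union_le _ _).trans_lt (add_lt_of_lt hτ.aleph0_le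
      (mk_image_le.trans_lt (mk_Iic_toType_lt hτ.aleph0_le i)) ?_)
    rw [mk_singleton]
    exact one_lt_aleph0.trans_le hτ.aleph0_le)
  have := nonempty_toType hτ
  choose! bd hbd using hdir
  let η : κ.ord.ToType → τ.ord.ToType := wellFounded_lt.fix fun k ih =>
    bd (Set.range fun j : Set.Iio k => g (ih j j.2))
  have hη : ∀ k, η k = bd (Set.range fun j : Set.Iio k => g (η j)) := fun k =>
    wellFounded_lt.fix_eq _ k
  have hsmall : ∀ (ι : Type u) (e : ι → τ.ord.ToType), #ι ≤ κ → #(Set.range e) < τ :=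
    fun ι e h => (mk_range_le.trans h).trans_lt hκτ
  have hstep : ∀ j k, j < k → g (η j) < η k := by
    intro j k hjk
    rw [hη k]
    exact hbd _ (hsmall _ _ ((mk_set_le _).trans (mk_ord_toType κ).le)) _ ⟨⟨j, hjk⟩, rfl⟩
  have hself : ∀ i, i < g i := fun i => hg i i (Or.inr rfl)
  have hmono : StrictMono η := fun j k hjk => (hself _).trans (hstep j k hjk)
  have hne : {δ | ∀ k, η k < δ}.Nonempty :=
    ⟨bd (Set.range η), fun k => hbd _ (hsmall _ _ (mk_ord_toType κ).le) _ ⟨k, rfl⟩⟩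
  obtain ⟨δ, hδ, hmin⟩ := wellFounded_lt.has_min _ hne
  have hcof : ∀ i < δ, ∃ k, i ≤ η k := by
    intro i hi
    by_contra! h
    exact hmin i h hi
  refine ⟨δ, ⟨η, hmono, hδ, fun i hi => ?_⟩, fun i hi => ?_⟩
  · obtain ⟨k, hk⟩ := hcof i hi
    obtain ⟨k', hk'⟩ := exists_gt k
    exact ⟨k', hk.trans_lt (hmono hk')⟩
  · obtain ⟨k, hk⟩ := hcof i hi
    obtain ⟨k', hk'⟩ := exists_gt k
    exact (hg (η k) (f i) (Or.inl ⟨i, hk, rfl⟩)).trans ((hstep k k' hk').trans (hδ k'))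

/-- Fodor's lemma: if `h` is regressive and unbounded on the members, closed under a given
function, of a set `E`, then some large value is attained on a stationary subset of `E`. -/
lemma exists_stationary_fiber (hτ : τ.IsRegular) (E : Set τ.ord.ToType)
    (h : τ.ord.ToType → τ.ord.ToType) (hh : ∀ δ ∈ E, h δ < δ) (β : τ.ord.ToType)
    (hβ : ∀ f, ∃ δ ∈ E, β ≤ h δ ∧ ClosedUnder f δ) :
    ∃ γ, β ≤ γ ∧ ∀ f, ∃ δ ∈ E, h δ = γ ∧ ClosedUnder f δ := by
  by_contra! hcon
  have : ∀ γ, ∃ f, β ≤ γ → ∀ δ ∈ E, h δ = γ → ¬ ClosedUnder f δ := by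
    intro γ
    by_cases hγ : β ≤ γ
    · obtain ⟨f, hf⟩ := hcon γ hγ
      exact ⟨f, fun _ => hf⟩
    · exact ⟨id, fun h => absurd h hγ⟩
  choose f hf using this
  -- the diagonal bound: `F i` exceeds `f γ j` for all `γ, j ≤ i`
  choose F hF using fun i : τ.ord.ToType => strictlyDirected_toType hτ
    ((fun q : τ.ord.ToType × τ.ord.ToType => f q.1 q.2) '' (Set.Iic i ×ˢ Set.Iic i)) (by
      refine mk_image_le.trans_lt ?_
      rw [mk_setProd]
      simpa using mul_lt_of_lt hτ.aleph0_le (mk_Iic_toType_lt hτ.aleph0_le i)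
        (mk_Iic_toType_lt hτ.aleph0_le i))
  obtain ⟨δ, hδ, hβδ, hcl⟩ := hβ F
  refine hf (h δ) hβδ δ hδ rfl fun j hj => ?_
  exact (hF (max (h δ) j) _ ⟨(h δ, j), ⟨le_max_left (h δ) j, le_max_right (h δ) j⟩, rfl⟩).trans
    (hcl _ (max_lt (hh δ hδ) hj))

/-- The colouring `p` splits the points of cofinality at least `κ` into stationary sets, one for
each colour. A set is called stationary here if, for every function `f`, it contains a point closed
under `f`; in a regular uncountable cardinal this is equivalent to meeting every club. -/
def IsStationaryColoring (κ τ : Cardinal.{u}) (p : τ.ord.ToType → τ.ord.ToType) : Prop :=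
  ∀ α f, ∃ δ, p δ = α ∧ DirectedBelow κ δ ∧ ClosedUnder f δ

/-- Solovay's theorem, for points of small cofinality: the points of cofinality at least `κ` of the
regular cardinal `τ` split into `τ` stationary sets. -/
theorem exists_stationary_coloring (hκ : κ.IsRegular) (hτ : τ.IsRegular) (hκτ : κ < τ) :
    ∃ p, IsStationaryColoring κ τ p := by
  have hdir := strictlyDirected_toType hτ
  have := nonempty_toType hτ
  let E : Set τ.ord.ToType := {δ | ∃ η, IsLadder κ η δ}
  have : ∀ δ, ∃ η : κ.ord.ToType → τ.ord.ToType, δ ∈ E → IsLadder κ η δ := by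
    intro δ
    by_cases hδ : δ ∈ E
    · obtain ⟨η, hη⟩ := hδ
      exact ⟨η, fun _ => hη⟩
    · exact ⟨fun _ => δ, fun h => absurd h hδ⟩
  choose η hη using this
  have hrange : ∀ e : κ.ord.ToType → τ.ord.ToType, #(Set.range e) < τ := fun e =>
    (mk_range_le.trans (mk_ord_toType κ).le).trans_lt hκτ
  -- since `κ < τ`, one coordinate of the ladders is unbounded on stationary sets
  obtain ⟨k, hk⟩ : ∃ k, ∀ β f, ∃ δ ∈ E, β ≤ η δ k ∧ ClosedUnder f δ := by
    by_contra! hcon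
    choose β f hβ using hcon
    obtain ⟨b, hb⟩ := hdir _ (hrange β)
    choose F hF using fun i => hdir _ (hrange fun k => f k i)
    obtain ⟨δ, hδ, hcl⟩ := exists_ladder_closedUnder hκ hτ hκτ fun i => max b (F i)
    obtain ⟨k₀⟩ := nonempty_toType hκ
    have hbδ : b < δ := (le_max_left _ _).trans_lt (hcl _ ((hη δ hδ).lt k₀))
    obtain ⟨k, hk⟩ := (hη δ hδ).cofinal b hbδ
    exact hβ k δ hδ ((hb _ ⟨k, rfl⟩).trans hk).le fun i hi =>
      (hF i _ ⟨k, rfl⟩).trans ((le_max_right _ _).trans_lt (hcl i hi))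
  let Γ : Set τ.ord.ToType := {γ | ∀ f, ∃ δ ∈ E, η δ k = γ ∧ ClosedUnder f δ}
  have hΓ : IsCofinal Γ := fun β => by
    obtain ⟨γ, hγ, hst⟩ := exists_stationary_fiber hτ E (fun δ => η δ k)
      (fun δ hδ => (hη δ hδ).lt k) β (hk β)
    exact ⟨γ, hst, hγ⟩
  have hcard : #τ.ord.ToType ≤ #Γ := by
    have := Order.cof_le hΓ
    rw [Ordinal.cof_toType, hτ.cof_ord] at this
    exact (mk_ord_toType τ).trans_le this
  obtain ⟨e⟩ := hcard
  have hinj : Function.Injective fun α => (e α : τ.ord.ToType) :=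
    Subtype.val_injective.comp e.injective
  refine ⟨fun δ => Function.invFun (fun α => (e α : τ.ord.ToType)) (η δ k), fun α f => ?_⟩
  obtain ⟨δ, hδ, hval, hcl⟩ := (e α).2 f
  refine ⟨δ, ?_, (hη δ hδ).directedBelow hκ, hcl⟩
  simp only [hval]
  exact Function.leftInverse_invFun hinj α

/-! ### Sums of reversed linear orders -/

/-- The sum, along the linear order `T`, of the reversals of the linear orders `X i`. If the blocks
are nonempty and `δ` is a limit point of `T`, then the cut in front of the block with index `δ` has
the cofinality of `δ` on its left side, and the cofinality of `X δ`, read downwards, on its right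
side. -/
abbrev BlockSum (T : Type u) (X : T → Type u) : Type u :=
  Σₗ i : T, (X i)ᵒᵈ

section BlockSum

variable {T : Type u} {X : T → Type u}

/-- The point `x` of the block with index `i`. -/
def block (i : T) (x : X i) : BlockSum T X := ⟨i, OrderDual.toDual x⟩

lemma exists_eq_block (z : BlockSum T X) : ∃ i x, z = block i x :=
  ⟨z.1, OrderDual.ofDual z.2, rfl⟩

lemma mk_blockSum_le {c : Cardinal.{u}} (hc : ℵ₀ ≤ c) (hT : #T ≤ c) (hX : ∀ i, #(X i) ≤ c) :
    #(BlockSum T X) ≤ c := by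
  have : #(BlockSum T X) = sum fun i => #(X i) := mk_sigma _
  rw [this]
  refine (sum_le_sum _ (fun _ => c) hX).trans ?_
  rw [sum_const']
  exact mul_le_of_le hc hT le_rfl

lemma mk_index_le_mk_blockSum [∀ i, Nonempty (X i)] : #T ≤ #(BlockSum T X) :=
  mk_le_of_injective (f := fun i => (block i (Classical.arbitrary (X i)) : BlockSum T X))
    fun _ _ h => congrArg Sigma.fst h

variable [LinearOrder T] [∀ i, LinearOrder (X i)]

lemma block_lt_of_lt {i j : T} (h : i < j) (x : X i) (y : X j) :
    (block i x : BlockSum T X) < block j y := Sigma.Lex.left _ _ h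

lemma block_lt_block_iff {i : T} {x y : X i} :
    (block i x : BlockSum T X) < block i y ↔ y < x := by
  refine ⟨fun h => ?_, fun h => Sigma.Lex.right _ _ h⟩
  rcases Sigma.Lex.lt_def.1 h with h | ⟨_, h⟩
  · exact absurd h (lt_irrefl i)
  · exact h

lemma block_injective (i : T) : Function.Injective (block i : X i → BlockSum T X) := by
  intro x y h
  rcases lt_trichotomy x y with hlt | heq | hlt
  · exact absurd h (block_lt_block_iff.2 hlt).ne'
  · exact heq
  · exact absurd h (block_lt_block_iff.2 hlt).ne

lemma fst_le_of_le {z w : BlockSum T X} (h : z ≤ w) : z.1 ≤ w.1 := by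
  by_contra! hlt
  obtain ⟨i, x, rfl⟩ := exists_eq_block z
  obtain ⟨j, y, rfl⟩ := exists_eq_block w
  exact absurd h (block_lt_of_lt hlt y x).not_ge

lemma strictlyDirected_blockSum {c : Cardinal.{u}} (hT : StrictlyDirected c T)
    [∀ i, Nonempty (X i)] : StrictlyDirected c (BlockSum T X) := by
  intro s hs
  obtain ⟨i, hi⟩ := hT (Sigma.fst '' s) (mk_image_le.trans_lt hs)
  refine ⟨block i (Classical.arbitrary _), fun z hz => ?_⟩
  obtain ⟨j, x, rfl⟩ := exists_eq_block z
  exact block_lt_of_lt (hi j ⟨_, hz, rfl⟩) _ _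

lemma mk_le_mk_blockSum (i : T) : #(X i) ≤ #(BlockSum T X) :=
  mk_le_of_injective (block_injective i)

end BlockSum

/-! ### Skeleton-like sequences for a binary relation -/

/-- `a` is weakly `κ`-skeleton like for the relation `R` on `A`: it turns the order of `I` into
`R`, and each `R · b` and each `R b ·` depends on the quantifier-free type over a set of fewer than
`κ` indices only. -/
structure IsSkeleton {I : Type u} [LinearOrder I] {A : Type u} (κ : Cardinal.{u})
    (R : A → A → Prop) (a : I → A) : Prop where
  rel_iff : ∀ s t, R (a s) (a t) ↔ s < t
  left : ∀ b, ∃ J : Set I, #J < κ ∧ ∀ s t, SameQFType J s t → (R (a s) b ↔ R (a t) b)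
  right : ∀ b, ∃ J : Set I, #J < κ ∧ ∀ s t, SameQFType J s t → (R b (a s) ↔ R b (a t))

/-- The sequences `a` and `b` are cofinally interleaved with respect to `R`. -/
def Interleaved {I J : Type u} [LinearOrder I] [LinearOrder J] {A : Type u} (R : A → A → Prop)
    (a : I → A) (b : J → A) : Prop :=
  (∀ᶠ s in atTop, ∀ᶠ t in atTop, R (a s) (b t)) ∧ ∀ᶠ t in atTop, ∀ᶠ s in atTop, R (b t) (a s)

variable {A : Type u} {R : A → A → Prop}

lemma Interleaved.symm {I J : Type u} [LinearOrder I] [LinearOrder J] {a : I → A} {b : J → A}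
    (h : Interleaved R a b) : Interleaved R b a := ⟨h.2, h.1⟩

lemma eventually_atTop_of_forall_ge {I : Type u} [LinearOrder I] {P : I → Prop} (v : I)
    (h : ∀ y, v ≤ y → P y) : ∀ᶠ y in atTop, P y :=
  (eventually_ge_atTop v).mono h

lemma exists_forall_ge_of_eventually {I : Type u} [LinearOrder I] [Nonempty I] {P : I → Prop}
    (h : ∀ᶠ y in atTop, P y) : ∃ v, ∀ y, v ≤ y → P y :=
  eventually_atTop.1 h

/-- A sequence is not interleaved with one whose cofinality exceeds its cardinality. -/
lemma not_interleaved_of_lt {I J : Type u} [LinearOrder I] [LinearOrder J] [Nonempty I]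
    (hR : ∀ x y, R x y → ¬ R y x) {a : I → A} {b : J → A}
    (hJ : StrictlyDirected (Order.succ #I) J) : ¬ Interleaved R a b := by
  rintro ⟨h1, h2⟩
  obtain ⟨v₀, -⟩ := hJ ∅ (by simp)
  have : Nonempty J := ⟨v₀⟩
  obtain ⟨s₀, hs₀⟩ := exists_forall_ge_of_eventually h1
  obtain ⟨t₀, ht₀⟩ := exists_forall_ge_of_eventually h2
  choose! t ht using fun s hs => exists_forall_ge_of_eventually (hs₀ s hs)
  obtain ⟨v, hv⟩ := hJ (Set.range t) (Order.lt_succ_of_le mk_range_le)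
  obtain ⟨s₁, hs₁⟩ := exists_forall_ge_of_eventually (ht₀ (max v t₀) (le_max_right _ _))
  exact hR _ _ (ht (max s₀ s₁) (le_max_left _ _) (max v t₀)
    ((hv _ ⟨_, rfl⟩).le.trans (le_max_left _ _))) (hs₁ _ (le_max_right _ _))

section Block

variable {T : Type u} [LinearOrder T] {X : T → Type u} [∀ i, LinearOrder (X i)]

lemma mk_preimage_block_lt {J : Set (BlockSum T X)} (hJ : #J < κ) (δ : T) :
    #{x : X δ | (block δ x : BlockSum T X) ∈ J} < κ :=
  (mk_preimage_of_injective (block δ) J (block_injective δ)).trans_lt hJ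

/-- A block is convex, so the parameters outside it do not separate its points. -/
lemma sameQFType_block {J : Set (BlockSum T X)} {δ : T} {x y : X δ}
    (h : SameQFType {x : X δ | (block δ x : BlockSum T X) ∈ J} x y) :
    SameQFType J (block δ x) (block δ y) := by
  intro z hw
  obtain ⟨i, w, rfl⟩ := exists_eq_block z
  rcases lt_trichotomy i δ with hi | rfl | hi
  · have hx := block_lt_of_lt hi w x
    have hy := block_lt_of_lt hi w y
    simp only [hx, hy, hx.ne', hy.ne', hx.not_gt, hy.not_gt, and_self]
  · obtain ⟨h1, h2, h3⟩ := h w hw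
    simp only [block_lt_block_iff, (block_injective i).eq_iff]
    exact ⟨h3, h2, h1⟩
  · have hx := block_lt_of_lt hi x w
    have hy := block_lt_of_lt hi y w
    simp only [hx, hy, hx.ne, hy.ne, hx.not_gt, hy.not_gt, and_self]

/-- The blocks of a skeleton-like sequence are skeleton-like for the converse relation. -/
lemma IsSkeleton.restrict_block {a : BlockSum T X → A} (ha : IsSkeleton κ R a) (δ : T) :
    IsSkeleton κ (Function.swap R) fun x : X δ => a (block δ x) where
  rel_iff s t := (ha.rel_iff _ _).trans block_lt_block_iff
  left b := by
    obtain ⟨J, hJ, h⟩ := ha.right b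
    exact ⟨_, mk_preimage_block_lt hJ δ, fun s t hst => h _ _ (sameQFType_block hst)⟩
  right b := by
    obtain ⟨J, hJ, h⟩ := ha.left b
    exact ⟨_, mk_preimage_block_lt hJ δ, fun s t hst => h _ _ (sameQFType_block hst)⟩

/-- A condition `R · b` that holds cofinally often on the left side of the cut in front of the block
`δ` holds near the cut on the right side as well, when both sides have cofinality at least `κ`. -/
lemma IsSkeleton.eventually_rel_of_frequently {a : BlockSum T X → A} (ha : IsSkeleton κ R a)
    {δ : T} (hδ : DirectedBelow κ δ) (hX : StrictlyDirected κ (X δ)) {b : A}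
    (hb : ∀ i < δ, ∃ k, i ≤ k ∧ k < δ ∧ ∃ x : X k, R (a (block k x)) b) :
    ∀ᶠ y : X δ in atTop, R (a (block δ y)) b := by
  obtain ⟨J, hJ, hJb⟩ := ha.left b
  obtain ⟨i, hi, hJi⟩ := hδ (Sigma.fst '' J ∩ Set.Iio δ)
    ((mk_le_mk_of_subset Set.inter_subset_left).trans_lt (mk_image_le.trans_lt hJ))
    fun _ h => h.2
  obtain ⟨v, hv⟩ := hX _ (mk_preimage_block_lt hJ δ)
  obtain ⟨k, hik, hkδ, x, hx⟩ := hb i hi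
  refine eventually_atTop_of_forall_ge v fun y hy => (hJb _ _ ?_).1 hx
  intro z hw
  obtain ⟨j, w, rfl⟩ := exists_eq_block z
  rcases lt_trichotomy j δ with hj | rfl | hj
  · have hjk : j < k := (hJi j ⟨⟨_, hw, rfl⟩, hj⟩).trans_le hik
    have hx := block_lt_of_lt hjk w x
    have hy := block_lt_of_lt hj w y
    simp only [hx, hy, hx.ne', hy.ne', hx.not_gt, hy.not_gt, and_self]
  · have hx := block_lt_of_lt hkδ x w
    have hy : (block j y : BlockSum T X) < block j w :=
      block_lt_block_iff.2 ((hv w hw).trans_le hy)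
    simp only [hx, hy, hx.ne, hy.ne, hx.not_gt, hy.not_gt, and_self]
  · have hx := block_lt_of_lt (hkδ.trans hj) x w
    have hy := block_lt_of_lt hj y w
    simp only [hx, hy, hx.ne, hy.ne, hx.not_gt, hy.not_gt, and_self]

end Block

lemma DirectedBelow.exists_lt {T : Type u} [LinearOrder T] {c : Cardinal.{u}} (hc : c.IsRegular)
    {δ : T} (hδ : DirectedBelow c δ) : ∃ i, i < δ := by
  obtain ⟨i, hi, -⟩ := hδ ∅ (by simpa using hc.pos) (by simp)
  exact ⟨i, hi⟩

section Transfer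

variable {T : Type u} [LinearOrder T] [Nonempty T] {X X' : T → Type u} [∀ i, LinearOrder (X i)]
  [∀ i, LinearOrder (X' i)] [∀ i, Nonempty (X i)] [∀ i, Nonempty (X' i)]
  {a : BlockSum T X → A} {a' : BlockSum T X' → A}

/-- One half of `Interleaved.exists_closedUnder`: at almost all places `δ`, each point of the block
`δ` of `a` lies above cofinally many points to the left of the block `δ` of `a'`, hence above `a'`
near the cut. -/
lemma exists_closedUnder_eventually_rel [NoMaxOrder T] (hκ : κ.IsRegular)
    (ha' : IsSkeleton κ R a')
    (h : ∀ᶠ t in atTop, ∀ᶠ s in atTop, R (a' t) (a s)) :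
    ∃ f : T → T, ∀ δ, ClosedUnder f δ → DirectedBelow κ δ → StrictlyDirected κ (X' δ) →
      ∀ x : X δ, ∀ᶠ y : X' δ in atTop, R (a' (block δ y)) (a (block δ x)) := by
  have hne : Nonempty (BlockSum T X) :=
    ⟨block (Classical.arbitrary T) (Classical.arbitrary _)⟩
  have hne' : Nonempty (BlockSum T X') :=
    ⟨block (Classical.arbitrary T) (Classical.arbitrary _)⟩
  obtain ⟨t₀, ht₀⟩ := exists_forall_ge_of_eventually h
  choose! s hs using fun t ht => exists_forall_ge_of_eventually (ht₀ t ht)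
  choose sc hsc using fun i : T => exists_gt i
  let r : ∀ k : T, BlockSum T X' := fun k => block k (Classical.arbitrary _)
  -- below a point closed under this function, the witnesses `s (r k)` stay to the left of it
  refine ⟨fun i => max (sc i) (max t₀.1 (s (r i)).1), fun δ hcl hδ hX x => ?_⟩
  refine ha'.eventually_rel_of_frequently hδ hX fun i hi => ?_
  have hi' := hcl i hi
  obtain ⟨i₁, hi₁⟩ := hδ.exists_lt hκ
  have ht₀δ : t₀.1 < δ := (le_max_left _ _).trans_lt ((le_max_right _ _).trans_lt (hcl i hi))
  let k := max i (sc t₀.1)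
  have hk : k < δ := max_lt hi ((le_max_left _ _).trans_lt (hcl _ ht₀δ))
  have ht₀k : t₀ ≤ r k := by
    by_contra! hlt
    exact absurd (fst_le_of_le hlt.le) ((hsc t₀.1).trans_le (le_max_right _ _)).not_ge
  refine ⟨k, le_max_left _ _, hk, Classical.arbitrary _, hs (r k) ht₀k _ ?_⟩
  have hsk : (s (r k)).1 < δ :=
    (le_max_right _ _).trans_lt ((le_max_right _ _).trans_lt (hcl k hk))
  by_contra! hlt
  exact absurd (fst_le_of_le hlt.le) hsk.not_ge

/-- Interleaved skeleton-like sequences have interleaved blocks, at almost all places `δ` of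
cofinality at least `κ`. -/
theorem Interleaved.exists_closedUnder [NoMaxOrder T] (hκ : κ.IsRegular) (ha : IsSkeleton κ R a)
    (ha' : IsSkeleton κ R a') (h : Interleaved R a a') :
    ∃ f : T → T, ∀ δ, ClosedUnder f δ → DirectedBelow κ δ → StrictlyDirected κ (X δ) →
      StrictlyDirected κ (X' δ) → Interleaved (Function.swap R) (fun x : X δ => a (block δ x))
        fun x : X' δ => a' (block δ x) := by
  obtain ⟨f, hf⟩ := exists_closedUnder_eventually_rel hκ ha' h.2
  obtain ⟨g, hg⟩ := exists_closedUnder_eventually_rel hκ ha h.1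
  refine ⟨fun i => max (f i) (g i), fun δ hcl hδ hX hX' => ⟨?_, ?_⟩⟩
  · exact .of_forall (hf δ (fun i hi => (le_max_left _ _).trans_lt (hcl i hi)) hδ hX')
  · exact .of_forall (hg δ (fun i hi => (le_max_right _ _).trans_lt (hcl i hi)) hδ hX)

end Transfer

/-! ### Cuts that are determined by a small set and a point -/

/-- The point `c` of `A` locates the end of the sequence `a` over the set `B`: on `B`, the
conditions `R · c` and `R · (a x)` agree for all large `x`, and some `L ⊆ B` of predecessors of `c`
approaches the end of `a` from the other side, so that whatever lies above `L` is eventually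
above `a`. -/
def LocatesOver {I : Type u} [LinearOrder I] (R : A → A → Prop) (B : Set A) (c : A) (a : I → A) :
    Prop :=
  ∃ L ⊆ B, (∀ b ∈ L, R b c) ∧ (∀ᶠ x in atTop, ∀ b ∈ B, R b (a x) ↔ R b c) ∧
    ∀ w, (∀ b ∈ L, R b w) → ∀ᶠ x in atTop, R (a x) w

/-- Sequences whose ends are located by the same point over the same set are interleaved. -/
lemma LocatesOver.interleaved {I J : Type u} [LinearOrder I] [LinearOrder J] {B : Set A} {c : A}
    {a : I → A} {a' : J → A} (h : LocatesOver R B c a) (h' : LocatesOver R B c a') :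
    Interleaved (Function.swap R) a a' := by
  obtain ⟨L, hL, h1, h2, h3⟩ := h
  obtain ⟨L', hL', h1', h2', h3'⟩ := h'
  exact ⟨h2.mono fun x hx => h3' _ fun b hb => (hx b (hL' hb)).2 (h1' b hb),
    h2'.mono fun x hx => h3 _ fun b hb => (hx b (hL hb)).2 (h1 b hb)⟩

/-- If cofinally many points to the left of the block `δ` lie in `B`, and the cofinality of the
block is larger than the cardinality of `B`, then the block is located over `B`. -/
lemma IsSkeleton.exists_locatesOver {T : Type u} [LinearOrder T] {X : T → Type u}
    [∀ i, LinearOrder (X i)] {a : BlockSum T X → A} (hκ : κ.IsRegular) (ha : IsSkeleton κ R a)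
    {δ : T} (hδ : DirectedBelow κ δ) (hX : StrictlyDirected κ (X δ)) {B : Set A}
    (hXB : StrictlyDirected (Order.succ #B) (X δ))
    (hB : ∀ i < δ, ∃ k, i ≤ k ∧ k < δ ∧ ∃ x : X k, a (block k x) ∈ B) :
    ∃ c, LocatesOver R B c fun x : X δ => a (block δ x) := by
  obtain ⟨v₀, -⟩ := hX ∅ (by simpa using hκ.pos)
  have : Nonempty (X δ) := ⟨v₀⟩
  have hconst : ∀ b : A, ∃ v : X δ, ∀ y y', v ≤ y → v ≤ y' →
      (R b (a (block δ y)) ↔ R b (a (block δ y'))) := by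
    intro b
    obtain ⟨J, hJ, h⟩ := (ha.restrict_block δ).left b
    obtain ⟨v, hv⟩ := hX J hJ
    refine ⟨v, fun y y' hy hy' => h y y' fun w hw => ?_⟩
    have h1 := (hv w hw).trans_le hy
    have h2 := (hv w hw).trans_le hy'
    simp only [h1, h2, h1.ne', h2.ne', h1.not_gt, h2.not_gt, and_self]
  choose v hv using hconst
  obtain ⟨m, hm⟩ := hXB (v '' B) (Order.lt_succ_of_le mk_image_le)
  refine ⟨a (block δ m), {b ∈ B | ∃ k < δ, ∃ x : X k, a (block k x) = b}, fun b hb => hb.1,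
    ?_, ?_, fun w hw => ?_⟩
  · rintro _ ⟨-, k, hk, x, rfl⟩
    exact (ha.rel_iff _ _).2 (block_lt_of_lt hk _ _)
  · exact eventually_atTop_of_forall_ge m fun x hx b hb =>
      hv b x m ((hm _ ⟨b, hb, rfl⟩).le.trans hx) (hm _ ⟨b, hb, rfl⟩).le
  · refine ha.eventually_rel_of_frequently hδ hX fun i hi => ?_
    obtain ⟨k, hik, hk, x, hx⟩ := hB i hi
    exact ⟨k, hik, hk, x, hw _ ⟨hx, k, hk, x, rfl⟩⟩

/-! ### Linear orders that code functions -/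

variable {lam : Cardinal.{u}}

/-- The linear order `κ` or `κ⁺`, according to the value of `b`. -/
abbrev BitOrder (κ : Cardinal.{u}) (b : Bool) : Type u :=
  (cond b κ (Order.succ κ)).ord.ToType

lemma isRegular_cond (hκ : κ.IsRegular) (b : Bool) : (cond b κ (Order.succ κ)).IsRegular := by
  cases b
  · exact isRegular_succ hκ.aleph0_le
  · exact hκ

lemma nonempty_bitOrder (hκ : κ.IsRegular) (b : Bool) : Nonempty (BitOrder κ b) :=
  nonempty_toType (isRegular_cond hκ b)

lemma strictlyDirected_bitOrder (hκ : κ.IsRegular) (b : Bool) :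
    StrictlyDirected κ (BitOrder κ b) := by
  refine (strictlyDirected_toType (isRegular_cond hκ b)).mono ?_
  cases b
  · exact Order.le_succ κ
  · exact le_rfl

lemma eq_of_interleaved_bitOrder (hκ : κ.IsRegular) (hR : ∀ x y, R x y → ¬ R y x) {b b' : Bool}
    {a : BitOrder κ b → A} {a' : BitOrder κ b' → A} (h : Interleaved R a a') : b = b' := by
  have hne : Nonempty (BitOrder κ true) := nonempty_toType hκ
  have hdir : StrictlyDirected (Order.succ #(BitOrder κ true)) (BitOrder κ false) := by
    have : #(BitOrder κ true) = κ := mk_ord_toType κ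
    rw [this]
    exact strictlyDirected_toType (isRegular_succ hκ.aleph0_le)
  cases b <;> cases b'
  · rfl
  · exact absurd h.symm (not_interleaved_of_lt hR hdir)
  · exact absurd h (not_interleaved_of_lt hR hdir)
  · rfl

/-- The linear order of cofinality `τ` that codes the function `f` on `τ`: in front of the block
`δ` the coinitiality is `κ` or `κ⁺`, according to the value of `f` at the colour of `δ`. -/
abbrev CodeOrder (κ τ : Cardinal.{u}) (p : τ.ord.ToType → τ.ord.ToType) (f : τ.ord.ToType → Bool) :
    Type u :=
  BlockSum τ.ord.ToType fun δ => BitOrder κ (f (p δ))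

section CodeOrder

variable {p : τ.ord.ToType → τ.ord.ToType} {f f' : τ.ord.ToType → Bool}

lemma nonempty_codeOrder (hκ : κ.IsRegular) (hτ : τ.IsRegular) :
    Nonempty (CodeOrder κ τ p f) := by
  obtain ⟨δ⟩ := nonempty_toType hτ
  obtain ⟨x⟩ := nonempty_bitOrder hκ (f (p δ))
  exact ⟨block δ x⟩

lemma strictlyDirected_codeOrder (hκ : κ.IsRegular) (hτ : τ.IsRegular) :
    StrictlyDirected τ (CodeOrder κ τ p f) := by
  have := fun δ => nonempty_bitOrder hκ (f (p δ))
  exact strictlyDirected_blockSum (strictlyDirected_toType hτ)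

lemma mk_codeOrder (hκ : κ.IsRegular) (hτ : τ.IsRegular) (hκτ : κ < τ) :
    #(CodeOrder κ τ p f) = τ := by
  have := fun δ => nonempty_bitOrder hκ (f (p δ))
  refine le_antisymm (mk_blockSum_le hτ.aleph0_le (mk_ord_toType τ).le fun δ => ?_)
    ((mk_ord_toType τ).ge.trans mk_index_le_mk_blockSum)
  rw [mk_ord_toType]
  cases f (p δ)
  · exact Order.succ_le_of_lt hκτ
  · exact hκτ.le

/-- Interleaved sequences that are indexed by code orders code the same function. -/
theorem eq_of_interleaved_codeOrder (hκ : κ.IsRegular) (hτ : τ.IsRegular)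
    (hp : IsStationaryColoring κ τ p) (hR : ∀ x y, R x y → ¬ R y x) {a : CodeOrder κ τ p f → A}
    {a' : CodeOrder κ τ p f' → A} (ha : IsSkeleton κ R a) (ha' : IsSkeleton κ R a')
    (h : Interleaved R a a') : f = f' := by
  have := fun δ => nonempty_bitOrder hκ (f (p δ))
  have := fun δ => nonempty_bitOrder hκ (f' (p δ))
  have := nonempty_toType hτ
  have := noMaxOrder hτ.aleph0_le
  obtain ⟨g, hg⟩ := h.exists_closedUnder hκ ha ha'
  funext α
  obtain ⟨δ, rfl, hδ, hcl⟩ := hp α g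
  exact eq_of_interleaved_bitOrder hκ (fun x y hxy => hR y x hxy)
    (hg δ hcl hδ (strictlyDirected_bitOrder hκ _) (strictlyDirected_bitOrder hκ _))

end CodeOrder

section SumCodeOrder

variable {ι : Type u} {τ : ι → Cardinal.{u}} {p : ∀ j, (τ j).ord.ToType → (τ j).ord.ToType}
  {q : ∀ j, (τ j).ord.ToType → ι} {f f' : (Σ j, (τ j).ord.ToType) → Bool}

/-- The linear order of cofinality `τ j` that codes a function `f` on the disjoint sum of the
cardinals `τ i`: the code orders of the restrictions of `f` appear, reversed, at stationarily many
places each. -/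
abbrev SumCodeOrder (κ : Cardinal.{u}) (τ : ι → Cardinal.{u})
    (p : ∀ j, (τ j).ord.ToType → (τ j).ord.ToType) (q : ∀ j, (τ j).ord.ToType → ι)
    (f : (Σ j, (τ j).ord.ToType) → Bool) (j : ι) : Type u :=
  BlockSum (τ j).ord.ToType fun δ =>
    CodeOrder κ (τ (q j (p j δ))) (p (q j (p j δ))) fun α => f ⟨q j (p j δ), α⟩

lemma strictlyDirected_sumCodeOrder (hκ : κ.IsRegular) (hτ : ∀ j, (τ j).IsRegular) (j : ι) :
    StrictlyDirected (τ j) (SumCodeOrder κ τ p q f j) := by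
  have := fun δ => nonempty_codeOrder (p := p (q j (p j δ)))
    (f := fun α => f ⟨q j (p j δ), α⟩) hκ (hτ _)
  exact strictlyDirected_blockSum (strictlyDirected_toType (hτ j))

/-- Interleaved sequences that are indexed by sum code orders code the same function. -/
theorem eq_of_interleaved_sumCodeOrder (hκ : κ.IsRegular) (hτ : ∀ j, (τ j).IsRegular)
    (hκτ : ∀ j, κ < τ j) (hp : ∀ j, IsStationaryColoring κ (τ j) (p j))
    (hq : ∀ j, Function.Surjective (q j)) (hR : ∀ x y, R x y → ¬ R y x) {j : ι}
    {a : SumCodeOrder κ τ p q f j → A} {a' : SumCodeOrder κ τ p q f' j → A}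
    (ha : IsSkeleton κ R a) (ha' : IsSkeleton κ R a') (h : Interleaved R a a') : f = f' := by
  have := nonempty_toType (hτ j)
  have := noMaxOrder (hτ j).aleph0_le
  have := fun δ => nonempty_codeOrder (p := p (q j (p j δ)))
    (f := fun α => f ⟨q j (p j δ), α⟩) hκ (hτ _)
  have := fun δ => nonempty_codeOrder (p := p (q j (p j δ)))
    (f := fun α => f' ⟨q j (p j δ), α⟩) hκ (hτ _)
  obtain ⟨g, hg⟩ := h.exists_closedUnder hκ ha ha'
  have key : ∀ i, (fun α => f ⟨i, α⟩) = fun α => f' ⟨i, α⟩ := by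
    intro i
    obtain ⟨β, rfl⟩ := hq j i
    obtain ⟨δ, rfl, hδ, hcl⟩ := hp j β g
    exact eq_of_interleaved_codeOrder hκ (hτ _) (hp _) (fun x y hxy => hR y x hxy)
      (ha.restrict_block δ) (ha'.restrict_block δ)
      (hg δ hcl hδ ((strictlyDirected_codeOrder hκ (hτ _)).mono (hκτ _).le)
        ((strictlyDirected_codeOrder hκ (hτ _)).mono (hκτ _).le))
  funext ⟨i, α⟩
  exact congrFun (key i) α

end SumCodeOrder

/-! ### Many linear orders, few of which have skeleton-like sequences in a given structure -/

/-- There are `2 ^ lam` linear orders of cardinality `lam` such that at most `lam` of them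
index a skeleton-like sequence in any one set of cardinality at most `lam` with an asymmetric
relation. -/
def HasSpreadOrders (κ lam : Cardinal.{u}) : Prop :=
  ∃ (F : Type u) (J : F → Type u) (_ : ∀ f, LinearOrder (J f)), #F = 2 ^ lam ∧
    (∀ f, #(J f) = lam) ∧ ∀ (A : Type u) (R : A → A → Prop), #A ≤ lam →
      (∀ x y, R x y → ¬ R y x) → #{f | ∃ a : J f → A, IsSkeleton κ R a} ≤ lam

lemma mk_setOf_le {F D : Type u} {P : F → Prop} (Q : F → D → Prop) (hD : #D ≤ lam)
    (hP : ∀ f, P f → ∃ d, Q f d) (hQ : ∀ f f' d, Q f d → Q f' d → f = f') :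
    #{f | P f} ≤ lam := by
  choose d hd using fun f : {f | P f} => hP f f.2
  refine (mk_le_of_injective (f := d) fun f f' h => ?_).trans hD
  exact Subtype.ext (hQ _ _ _ (hd f) (h ▸ hd f'))

lemma exists_injective_toType (hA : #A ≤ lam) :
    ∃ e : A → lam.ord.ToType, Function.Injective e := by
  rw [← mk_ord_toType lam] at hA
  obtain ⟨e⟩ := hA
  exact ⟨e, e.injective⟩

lemma mk_preimage_Iio_lt {e : A → lam.ord.ToType} (he : Function.Injective e)
    (i : lam.ord.ToType) : #(e ⁻¹' Set.Iio i) < lam :=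
  (mk_preimage_of_injective e _ he).trans_lt (mk_Iio_toType_lt i)

/-- For regular `lam`, the code order of `f` stands, reversed, to the right of a cut whose left side
has cofinality below `lam`; hence it is located over a proper initial segment of any enumeration of
the structure in type `lam`. -/
lemma hasSpreadOrders_of_isRegular (hκ : κ.IsRegular) (hlam : lam.IsRegular) (h : κ < lam) :
    HasSpreadOrders κ lam := by
  obtain ⟨p, hp⟩ := exists_stationary_coloring hκ hlam h
  have hsucc : (Order.succ κ).IsRegular := isRegular_succ hκ.aleph0_le
  have hne := fun f => nonempty_codeOrder (p := p) (f := f) hκ hlam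
  refine ⟨lam.ord.ToType → Bool,
    fun f => BlockSum (Order.succ κ).ord.ToType fun _ => CodeOrder κ lam p f,
    fun f => inferInstance, ?_, fun f => ?_, fun A R hA hR => ?_⟩
  · simp
  · refine le_antisymm (mk_blockSum_le hlam.aleph0_le ?_ fun _ => (mk_codeOrder hκ hlam h).le) ?_
    · rw [mk_ord_toType]
      exact Order.succ_le_of_lt h
    · obtain ⟨δ⟩ := nonempty_toType hsucc
      exact (mk_codeOrder hκ hlam h).ge.trans
        (mk_le_mk_blockSum (X := fun _ => CodeOrder κ lam p f) δ)
  obtain ⟨e, he⟩ := exists_injective_toType hA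
  refine mk_setOf_le (D := lam.ord.ToType × A) (fun f d => ∃ a : CodeOrder κ lam p f → A,
    IsSkeleton κ (Function.swap R) a ∧ LocatesOver R (e ⁻¹' Set.Iio d.1) d.2 a) ?_ ?_ ?_
  · rw [mk_prod, lift_id, lift_id, mk_ord_toType]
    exact mul_le_of_le hlam.aleph0_le le_rfl hA
  · rintro f ⟨a, ha⟩
    obtain ⟨δ, ⟨η, hη⟩, -⟩ := exists_ladder_closedUnder hκ hsucc (Order.lt_succ κ) id
    obtain ⟨i, hi⟩ := strictlyDirected_toType hlam
      ((fun k => e (a (block k (Classical.arbitrary _)))) '' Set.Iio δ)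
      (mk_image_le.trans_lt ((mk_Iio_toType_lt δ).trans_le (Order.succ_le_of_lt h)))
    have hX := strictlyDirected_codeOrder (p := p) (f := f) hκ hlam
    obtain ⟨c, hc⟩ := ha.exists_locatesOver hκ (hη.directedBelow hκ) (hX.mono h.le)
      (B := e ⁻¹' Set.Iio i) (hX.mono (Order.succ_le_of_lt (mk_preimage_Iio_lt he i)))
      fun k hk => ⟨k, le_rfl, hk, Classical.arbitrary _, hi _ ⟨k, hk, rfl⟩⟩
    exact ⟨(i, c), _, ha.restrict_block δ, hc⟩
  · rintro f f' d ⟨a, ha, hd⟩ ⟨a', ha', hd'⟩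
    exact eq_of_interleaved_codeOrder hκ hlam hp (fun x y hxy => hR y x hxy) ha ha'
      (hd.interleaved hd')

/-- A singular cardinal is the supremum of fewer regular cardinals, which may be chosen above any
given `κ` and above their own number. -/
lemma exists_regular_cofinal (hlam : ℵ₀ ≤ lam) (hsing : ¬ lam.IsRegular) (hκ : ℵ₀ ≤ κ)
    (h : κ < lam) : ∃ (ι : Type u) (g : ι → lam.ord.ToType) (τ : ι → Cardinal.{u}),
      (∀ i, ∃ j, i ≤ g j) ∧ (∀ j, (τ j).IsRegular) ∧ (∀ j, κ < τ j) ∧ (∀ j, τ j < lam) ∧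
      (∀ j, #ι < τ j) ∧ ∀ c < lam, ∃ j, c < τ j := by
  have hcof : lam.ord.cof < lam := by
    by_contra! hle
    exact hsing ⟨hlam, hle⟩
  have hsucc : ∀ c < lam, Order.succ c < lam := by
    intro c hc
    refine (Order.succ_le_of_lt hc).lt_of_ne fun heq => hsing ?_
    have hc' : ℵ₀ ≤ c := by
      by_contra! hfin
      exact absurd hlam (heq ▸ (isStrongLimit_aleph0.isSuccLimit.succ_lt hfin)).not_ge
    exact heq ▸ isRegular_succ hc'
  obtain ⟨S, hS, hcard⟩ := Order.exists_cof_eq lam.ord.ToType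
  rw [Ordinal.cof_toType] at hcard
  have hle : ∀ j : S, ℵ₀ ≤ max κ (max #S #(Set.Iio (j : lam.ord.ToType))) :=
    fun j => hκ.trans (le_max_left _ _)
  refine ⟨S, (↑), fun j => Order.succ (max κ (max #S #(Set.Iio (j : lam.ord.ToType)))),
    fun i => ?_, fun j => isRegular_succ (hle j),
    fun j => Order.lt_succ_of_le (le_max_left _ _), fun j => hsucc _ ?_,
    fun j => Order.lt_succ_of_le ((le_max_left _ _).trans (le_max_right _ _)), fun c hc => ?_⟩
  · obtain ⟨j, hj, hij⟩ := hS i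
    exact ⟨⟨j, hj⟩, hij⟩
  · exact max_lt h (max_lt (hcard ▸ hcof) (mk_Iio_toType_lt _))
  · -- the point of rank `c` has `c` predecessors
    have hlt : c.ord < Ordinal.type (α := lam.ord.ToType) (· < ·) := by
      rw [Ordinal.type_toType]
      exact ord_lt_ord.2 hc
    obtain ⟨i, hi⟩ := Ordinal.typein_surj (α := lam.ord.ToType) (· < ·) hlt
    obtain ⟨j, hj, hij⟩ := hS i
    refine ⟨⟨j, hj⟩, Order.lt_succ_of_le ?_⟩
    have h1 : #(Set.Iio i) = c := by
      have := congrArg Ordinal.card hi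
      rwa [card_ord] at this
    exact (h1.ge.trans (mk_le_mk_of_subset (Set.Iio_subset_Iio hij))).trans
      ((le_max_right _ _).trans (le_max_right _ _))

/-- If fewer than `τ` sets cover the regular cardinal `τ`, then one of them is unbounded. -/
lemma exists_unbounded_fiber {τ : Cardinal.{u}} (hτ : τ.IsRegular) {ι : Type u} (hι : #ι < τ)
    (P : ι → τ.ord.ToType → Prop) (hP : ∀ k, ∃ j, P j k) :
    ∃ j, ∀ i, ∃ k, i < k ∧ P j k := by
  by_contra! hcon
  choose i hi using hcon
  obtain ⟨v, hv⟩ := strictlyDirected_toType hτ (Set.range i) (mk_range_le.trans_lt hι)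
  obtain ⟨j, hj⟩ := hP v
  exact hi j v (hv _ ⟨j, rfl⟩) hj

/-- For singular `lam`, the sum code orders of `f`, of arbitrarily large cofinality `τ j < lam`,
stand, reversed, to the right of stationarily many cuts of a sum of regular length `τ j₀ > cof lam`.
Cofinally many blocks of that sum meet one proper initial segment of the structure, and some `τ j`
exceeds the cardinality of that segment. -/
lemma hasSpreadOrders_of_not_isRegular (hκ : κ.IsRegular) (hsing : ¬ lam.IsRegular) (h : κ < lam) :
    HasSpreadOrders κ lam := by
  have hlam : ℵ₀ ≤ lam := hκ.aleph0_le.trans h.le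
  obtain ⟨ι, g, τ, hg, hτ, hκτ, hτlam, hι, hcof⟩ :=
    exists_regular_cofinal hlam hsing hκ.aleph0_le h
  obtain ⟨j₀, -⟩ := hcof _ h
  have : Nonempty ι := ⟨j₀⟩
  choose p hp using fun j => exists_stationary_coloring hκ (hτ j) (hκτ j)
  have : ∀ j, ∃ q : (τ j).ord.ToType → ι, Function.Surjective q := by
    intro j
    have hle : #ι ≤ #(τ j).ord.ToType := (hι j).le.trans (mk_ord_toType _).ge
    obtain ⟨e⟩ := hle
    exact ⟨Function.invFun e, Function.invFun_surjective e.injective⟩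
  choose q hq using this
  have hιlam : #ι ≤ lam := ((hι j₀).trans (hτlam j₀)).le
  have hsum : #(Σ j, (τ j).ord.ToType) = lam := by
    refine le_antisymm ?_ (le_of_forall_lt fun c hc => ?_)
    · rw [mk_sigma]
      refine (sum_le_sum _ (fun _ => lam) fun j => ?_).trans ?_
      · rw [mk_ord_toType]
        exact (hτlam j).le
      · rw [sum_const']
        exact mul_le_of_le hlam hιlam le_rfl
    · obtain ⟨j, hj⟩ := hcof c hc
      rw [mk_sigma]
      exact hj.trans_le ((mk_ord_toType (τ j)).ge.trans
        (le_sum (fun j => #(τ j).ord.ToType) j))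
  have hne₀ := fun j δ (f : (Σ j, (τ j).ord.ToType) → Bool) => nonempty_codeOrder
    (p := p (q j (p j δ))) (f := fun α => f ⟨q j (p j δ), α⟩) hκ (hτ _)
  have hne : ∀ f j, Nonempty (SumCodeOrder κ τ p q f j) := by
    intro f j
    obtain ⟨δ⟩ := nonempty_toType (hτ j)
    obtain ⟨x⟩ := hne₀ j δ f
    exact ⟨block δ x⟩
  have hmk : ∀ f j, #(SumCodeOrder κ τ p q f j) ≤ lam := fun f j =>
    mk_blockSum_le hlam ((mk_ord_toType _).le.trans (hτlam j).le) fun δ =>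
      (mk_codeOrder hκ (hτ _) (hκτ _)).le.trans (hτlam _).le
  refine ⟨(Σ j, (τ j).ord.ToType) → Bool,
    fun f => BlockSum (τ j₀).ord.ToType fun δ => SumCodeOrder κ τ p q f (q j₀ (p j₀ δ)),
    fun f => inferInstance, ?_, fun f => ?_, fun A R hA hR => ?_⟩
  · rw [mk_arrow, hsum]
    simp
  · refine le_antisymm (mk_blockSum_le hlam ((mk_ord_toType _).le.trans (hτlam j₀).le)
      fun δ => hmk f _) (le_of_forall_lt fun c hc => ?_)
    obtain ⟨j, hj⟩ := hcof c hc
    obtain ⟨β, rfl⟩ := hq j₀ j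
    obtain ⟨δ, rfl, -⟩ := hp j₀ β id
    refine hj.trans_le ((mk_ord_toType _).ge.trans
      (le_trans ?_ (mk_le_mk_blockSum (X := fun δ => SumCodeOrder κ τ p q f (q j₀ (p j₀ δ))) δ)))
    have := hne₀ (q j₀ (p j₀ δ))
    have := fun δ' => this δ' f
    exact mk_index_le_mk_blockSum
  obtain ⟨e, he⟩ := exists_injective_toType hA
  refine mk_setOf_le (D := ι × ι × A) (fun f d => ∃ a : SumCodeOrder κ τ p q f d.1 → A,
    IsSkeleton κ (Function.swap R) a ∧ LocatesOver R (e ⁻¹' Set.Iio (g d.2.1)) d.2.2 a) ?_ ?_ ?_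
  · simp only [mk_prod, lift_id]
    exact mul_le_of_le hlam hιlam (mul_le_of_le hlam hιlam hA)
  · rintro f ⟨a, ha⟩
    have hmax := noMaxOrder hlam
    -- one of the sets of the filtration contains representatives of cofinally many blocks
    obtain ⟨i, hi⟩ := exists_unbounded_fiber (hτ j₀) (hι j₀)
      (fun i k => e (a (block k (Classical.arbitrary _))) < g i) fun k => by
        obtain ⟨x, hx⟩ := exists_gt (e (a (block k (Classical.arbitrary _))))
        obtain ⟨i, hi⟩ := hg x
        exact ⟨i, hx.trans_le hi⟩
    choose n hn hn' using hi
    -- some blocks of cofinality larger than that set occur at places closed under `n`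
    obtain ⟨j, hj⟩ := hcof _ (mk_preimage_Iio_lt he (g i))
    obtain ⟨β, rfl⟩ := hq j₀ j
    obtain ⟨δ, rfl, hδ, hcl⟩ := hp j₀ β n
    have hX := strictlyDirected_sumCodeOrder (p := p) (q := q) (f := f) hκ hτ (q j₀ (p j₀ δ))
    obtain ⟨c, hc⟩ := ha.exists_locatesOver hκ hδ (hX.mono (hκτ _).le)
      (B := e ⁻¹' Set.Iio (g i)) (hX.mono (Order.succ_le_of_lt hj))
      fun k hk => ⟨n k, (hn k).le, hcl k hk, Classical.arbitrary _, hn' k⟩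
    exact ⟨(q j₀ (p j₀ δ), i, c), _, ha.restrict_block δ, hc⟩
  · rintro f f' d ⟨a, ha, hd⟩ ⟨a', ha', hd'⟩
    exact eq_of_interleaved_sumCodeOrder hκ hτ hκτ hp hq (fun x y hxy => hR y x hxy) ha ha'
      (hd.interleaved hd')

theorem hasSpreadOrders (hκ : κ.IsRegular) (h : κ < lam) : HasSpreadOrders κ lam := by
  by_cases hlam : lam.IsRegular
  · exact hasSpreadOrders_of_isRegular hκ hlam h
  · exact hasSpreadOrders_of_not_isRegular hκ hlam h

/-! ### Isomorphic models and the number of isomorphism types -/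

variable {τ : Vocabulary.{v, w}}

lemma nonempty_iso_refl (M : Model.{u} τ) : Nonempty (Iso M M) :=
  ⟨⟨Equiv.refl _, fun _ _ => rfl, fun _ _ => Iff.rfl⟩⟩

lemma nonempty_iso_symm {M N : Model.{u} τ} (h : Nonempty (Iso M N)) : Nonempty (Iso N M) := by
  obtain ⟨f⟩ := h
  refine ⟨⟨f.toEquiv.symm, fun F x => ?_, fun r x => ?_⟩⟩
  · rw [Equiv.symm_apply_eq, f.map_func]
    simp
  · rw [f.map_rel]
    simp

lemma nonempty_iso_trans {M N P : Model.{u} τ} (h : Nonempty (Iso M N))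
    (h' : Nonempty (Iso N P)) : Nonempty (Iso M P) := by
  obtain ⟨f⟩ := h
  obtain ⟨g⟩ := h'
  refine ⟨⟨f.toEquiv.trans g.toEquiv, fun F x => ?_, fun r x => ?_⟩⟩
  · simp [f.map_func, g.map_func]
  · rw [f.map_rel, g.map_rel]
    rfl

/-- Isomorphism, as an equivalence relation on `τ`-models. -/
def isoSetoid (τ : Vocabulary.{v, w}) : Setoid (Model.{u} τ) where
  r M N := Nonempty (Iso M N)
  iseqv := ⟨nonempty_iso_refl, nonempty_iso_symm, nonempty_iso_trans⟩

lemma isSkeleton_of_isWeaklySkeletonLike {n : ℕ} {φ : BinFormula.{u} τ n} {M : Model.{u} τ}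
    {I : Type u} [LinearOrder I] {a : I → Fin n → M.Carrier}
    (h : IsWeaklySkeletonLike κ φ M a) : IsSkeleton κ (φ.Holds M) a where
  rel_iff := h.holds_iff
  left b := h.skeleton _ ⟨b, Or.inl rfl⟩
  right b := h.skeleton _ ⟨b, Or.inr rfl⟩

lemma IsSkeleton.map_iso {n : ℕ} {φ : BinFormula.{u} τ n} {M N : Model.{u} τ} (f : Iso M N)
    {I : Type u} [LinearOrder I] {a : I → Fin n → M.Carrier} (h : IsSkeleton κ (φ.Holds M) a) :
    IsSkeleton κ (φ.Holds N) fun s i => f.toEquiv (a s i) := by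
  have key : ∀ (b : Fin n → N.Carrier), ∃ b' : Fin n → M.Carrier, b = fun i => f.toEquiv (b' i) :=
    fun b => ⟨fun i => f.toEquiv.symm (b i), by simp⟩
  refine ⟨fun s t => ?_, fun b => ?_, fun b => ?_⟩
  · rw [← φ.holds_iso M N f]
    exact h.rel_iff s t
  · obtain ⟨b, rfl⟩ := key b
    simp only [← φ.holds_iso M N f]
    exact h.left b
  · obtain ⟨b, rfl⟩ := key b
    simp only [← φ.holds_iso M N f]
    exact h.right b

/-- A partition of a set of cardinality `2 ^ lam` into classes of cardinality at most `lam` has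
`2 ^ lam` classes. -/
lemma mk_quotient_eq {F : Type u} (hlam : ℵ₀ ≤ lam) (hF : #F = 2 ^ lam) (S : Setoid F)
    (hS : ∀ f, #{f' | S f' f} ≤ lam) : #(Quotient S) = 2 ^ lam := by
  refine le_antisymm (mk_quotient_le.trans hF.le) ?_
  by_contra! hlt
  have hle : #F ≤ #(Quotient S) * lam := by
    rw [← mk_univ, ← Set.iUnion_of_singleton F]
    have h1 : (⋃ x : F, {x}) = ⋃ c : Quotient S, {f' | Quotient.mk S f' = c} := by
      ext x
      simp
    rw [h1]
    refine (mk_iUnion_le_sum_mk).trans ((sum_le_sum _ (fun _ => lam) fun c => ?_).trans ?_)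
    · induction c using Quotient.inductionOn with | _ f =>
      simpa only [Quotient.eq] using hS f
    · rw [sum_const']
  rw [hF] at hle
  exact absurd hle (mul_lt_of_lt (hlam.trans (cantor lam).le) hlt (cantor lam)).not_ge

end OrderCoding

theorem theorem3p9 (lam κ : Cardinal.{u}) (hκ : κ.IsRegular) (hlam : κ < lam)
    (τ : Vocabulary.{v, w}) (K : Set (Vocabulary.Model.{u} τ))
    (hK : ∀ M ∈ K, #M.Carrier = lam)
    (n : ℕ) (φ : Vocabulary.BinFormula.{u} τ n) (hφ : ∀ M ∈ K, φ.AsymmetricIn M)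
    (hskel : ∀ (J : Type u) [LinearOrder J], #J = lam →
      ∃ M ∈ K, ∃ a : J → Fin n → M.Carrier, Vocabulary.IsWeaklySkeletonLike κ φ M a) :
    ∃ (ι : Type u) (N : ι → Vocabulary.Model.{u} τ), #ι = 2 ^ lam ∧ (∀ i, N i ∈ K) ∧
      ∀ i j, i ≠ j → IsEmpty (Vocabulary.Iso (N i) (N j)) := by
  have hinf : ℵ₀ ≤ lam := hκ.aleph0_le.trans hlam.le
  obtain ⟨F, J, hJ, hF, hcard, hfew⟩ := OrderCoding.hasSpreadOrders hκ hlam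
  choose M hMK a ha using fun f => hskel (J f) (hcard f)
  let S : Setoid F := (OrderCoding.isoSetoid τ).comap M
  refine ⟨Quotient S, fun c => M c.out, ?_, fun c => hMK _, fun c c' hcc' => ?_⟩
  · refine OrderCoding.mk_quotient_eq hinf hF S fun f => ?_
    have hA : #(Fin n → (M f).Carrier) ≤ lam := by
      rw [mk_arrow, hK _ (hMK f)]
      simpa using power_nat_le hinf
    refine (mk_le_mk_of_subset ?_).trans (hfew _ (φ.Holds (M f)) hA (hφ _ (hMK f)))
    rintro f' ⟨i⟩
    exact ⟨_, (OrderCoding.isSkeleton_of_isWeaklySkeletonLike (ha f')).map_iso i⟩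
  · refine not_nonempty_iff.1 fun hiso => hcc' ?_
    rw [← c.out_eq, ← c'.out_eq]
    exact Quotient.sound hiso
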